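/- **Theorem 5 (algebraic curve of the disk amplitude).** Let $p\ge 1$, $\omega=e^{2\pi i/p}$, and let $b=(b_n)_{n\ge1}$ be a background, i.e. a sequence of complex numbers with only finitely many $b_n\neq0$ (for $(p,q)$ minimal strings $b_n=0$ for $n>p+q$). Let $|\Phi\rangle$ be a state with $\langle b/g|\Phi\rangle\ne0$, regarded as the formal power series $\langle b/g|e^{\sum_{n\ge1}j_n\alpha_n}|\Phi\rangle$ in the sources $j_1,j_2,\dots$, given up to a common factor, with coefficients formal Laurent series in the string coupling $g$. The oscillators act by $\alpha_n=\partial/\partial j_n$ and $\alpha_{-n}=n(b_n/g+j_n)$ for $n\ge1$, and $\alpha_0=0$. Write $\langle A\rangle=\langle b/g|A|\Phi\rangle/\langle b/g|\Phi\rangle$, and suppose that the connected correlation functions, generated by $\log\langle e^{\sum_n j_n\alpha_n}\rangle$, have the genus expansion $$\langle\alpha_{n_1}\cdots\alpha_{n_N}\rangle_{\rm c}=\sum_{h\ge0}g^{2h+N-2}\langle\alpha_{n_1}\cdots\alpha_{n_N}\rangle^{(h)}_{\rm c}\qquad(N\ge1,\ n_i\ge1).$$ Let $\varphi_0,\dots,\varphi_{p-1}$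 be the twisted chiral bosons, $\partial\varphi_a(\zeta)=\frac1p\sum_{n\in\mathbb Z}\omega^{-na}\alpha_n\zeta^{-n/p-1}$, let $\mathcal W^s_a(\zeta)=\,:\!e^{-\varphi_a(\zeta)}\partial_\zeta^s e^{\varphi_a(\zeta)}\!:$, where $:\ :$ is the normal ordering for the $SL(2,\mathbb C)$-invariant vacuum of the $\zeta$-plane, let $W^s(\zeta)=\sum_{a=0}^{p-1}\mathcal W^s_a(\zeta)=\sum_{n\in\mathbb Z}W^s_n\zeta^{-n-s}$, and suppose that $|\Phi\rangle$ satisfies the $W_{1+\infty}$ constraints $$W^s_n|\Phi\rangle=0\qquad(s\ge1,\ n\ge-s+1).$$ Let $Q_a(\zeta)=\langle\partial\varphi_a(\zeta)\rangle^{(0)}$ $(a=0,\dots,p-1)$ be the genus-zero disk amplitude on the $a$-th sheet, i.e. the part of order $g^{-1}$ of $\langle\partial\varphi_a(\zeta)\rangle$, a formal Laurent series in $\zeta^{-1/p}$. For $f=\sum_n c_n\zeta^{n/p}$ put $[f]_{\rm pol}=\sum_{l\ge0}c_{lp}\zeta^l$. Put $a_s(\zeta)=\frac ps[Q_0^s(\zeta)]_{\rm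 pol}\in\mathbb C[\zeta]$, and define the Schur polynomials by $\exp\bigl(\sum_{s\ge1}x_s\lambda^s\bigr)=\sum_{k\ge0}\mathcal S_k(x)\lambda^k$. Then: 1. $Q_a(\zeta)=Q_0(e^{2\pi ia}\zeta)$ for $0\le a<p$. 2. (Weak-coupling limit) $\langle\mathcal W^s_a(\zeta)\rangle=g^{-s}Q_a(\zeta)^s+O(g^{-s+1})$ for all $s\ge1$ and $0\le a<p$, coefficientwise in $\zeta^{1/p}$. 3. (Master equations) $\displaystyle\sum_{a=0}^{p-1}Q_a(\zeta)^s=p\,[Q_0(\zeta)^s]_{\rm pol}=s\,a_s(\zeta)$ for all $s\ge1$. 4. (Algebraic curve) $\displaystyle\prod_{a=0}^{p-1}\bigl(Q-Q_a(\zeta)\bigr)=F(\zeta,Q):=\sum_{k=0}^{p}Q^{p-k}\,\mathcal S_k\bigl(-a(\zeta)\bigr)$, which is a polynomial in both $\zeta$ and $Q$, and the disk amplitude satisfies $F(\zeta,Q_0(\zeta))=0$. -/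

import Mathlib

namespace MinimalString

noncomputable section

/-! ### Formal series -/

/-- Formal Laurent series in the string coupling `g`; `HahnSeries.single k c` is `c * g ^ k`. -/
abbrev GSeries : Type := LaurentSeries ℂ

/-- Formal Laurent series `∑ c_k z ^ k` in `z = ζ ^ (-1 / p)`, i.e. expansions
`∑ c_k ζ ^ (-k / p)` around `ζ = ∞` with finitely many positive powers of `ζ`. -/
abbrev ZSeries : Type := LaurentSeries ℂ

/-- States in the oscillator representation around a background `b`: the state `|Φ⟩` is the formal
power series `⟨b/g| exp (∑_{n ≥ 1} j_n α_n) |Φ⟩` in the sources `j_1, j_2, …`, known up to a common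
factor, with coefficients that are Laurent series in `g`. -/
abbrev FockState : Type := MvPowerSeries ℕ+ GSeries

/-! ### Oscillators and expectation values -/

/-- The oscillators in the background `b`, i.e. on `⟨x/g|` with `x_n / g = b_n / g + j_n`:
`α_n = ∂ / ∂j_n` and `α_{-n} = n (b_n / g + j_n)` for `n ≥ 1`; `⟨x/g| α_0 = 0`. -/
def alpha (b : ℕ+ →₀ ℂ) : ℤ → Module.End GSeries FockState
  | Int.ofNat 0 => 0
  | Int.ofNat (n + 1) => (MvPowerSeries.pderiv GSeries n.succPNat : FockState →ₗ[GSeries] FockState)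
  | Int.negSucc n => Algebra.lmul GSeries FockState
      (((n + 1 : ℕ) : FockState) * (MvPowerSeries.C (HahnSeries.single (-1 : ℤ) (b n.succPNat))
        + MvPowerSeries.X n.succPNat))

/-- The oscillator normal ordered product `⦂α_{m_1} ⋯ α_{m_r}⦂`
(negative modes to the left of the others). -/
def normalProd (b : ℕ+ →₀ ℂ) {r : ℕ} (m : Fin r → ℤ) : Module.End GSeries FockState :=
  (((List.ofFn m).filter (fun n => n < 0)).map (alpha b)).prod *
    (((List.ofFn m).filter (fun n => 0 ≤ n)).map (alpha b)).prod

/-- `⟨A⟩ = ⟨b/g| A |Φ⟩ / ⟨b/g|Φ⟩`, where `AΦ` is the state `A |Φ⟩`. -/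
def vev (Φ AΦ : FockState) : GSeries :=
  MvPowerSeries.constantCoeff AΦ / MvPowerSeries.constantCoeff Φ

/-- The genus expansion
`⟨O_{n_1} ⋯ O_{n_N}⟩_c = ∑_{h ≥ 0} g ^ (2 h + N - 2) ⟨O_{n_1} ⋯ O_{n_N}⟩_c^{(h)}`
of the connected correlation functions (`N ≥ 1`). These are, up to factorials, the coefficients of
`F = log (Φ / Φ|_{j = 0})`, the generating function of the connected correlation functions. -/
def HasGenusExpansion (Φ : FockState) : Prop :=
  ∃ F : FockState, MvPowerSeries.constantCoeff F = 0 ∧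
    Φ = MvPowerSeries.C (MvPowerSeries.constantCoeff Φ) * (PowerSeries.exp ℚ).subst F ∧
    ∀ (β : ℕ+ →₀ ℕ) (k : ℤ), (MvPowerSeries.coeff β F).coeff k ≠ 0 →
      ∃ h : ℕ, k = 2 * (h : ℤ) + (β.degree : ℤ) - 2

/-! ### The twisted bosons and the `W_{1+∞}` currents -/

/-- `ω = exp (2 π i / p)`. -/
def omega (p : ℕ) : ℂ := Complex.exp (2 * Real.pi * Complex.I / p)

/-- Coefficient of `α_n ζ ^ (-n / p - 1)` in
`∂φ_a(ζ) = (1 / p) ∑_n ω ^ (- n a) α_n ζ ^ (-n / p - 1)`. -/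
def phiCoeff (p a : ℕ) (n : ℤ) : ℂ := omega p ^ (-(n * a)) / p

/-- Coefficient of `α_n ζ ^ (-n / p)`, as a power series in `ε`, in
`φ_a(ζ (1 + ε)) - φ_a(ζ) = ∫_0^ε ζ ∂φ_a(ζ (1 + t)) dt`,
namely `phiCoeff p a n * ∫_0^ε (1 + t) ^ (-n / p - 1) dt`. -/
def phiIncrement (p a : ℕ) (n : ℤ) : PowerSeries ℂ :=
  PowerSeries.mk fun
    | 0 => 0
    | k + 1 => phiCoeff p a n *
        PowerSeries.coeff k (PowerSeries.binomialSeries ℂ (-(n : ℚ) / p - 1)) / ((k : ℂ) + 1)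

/-- The power series `((1 + ε) ^ (1 / p) - 1) / ε`. -/
def rootQuotient (p : ℕ) : PowerSeries ℂ :=
  PowerSeries.mk fun k =>
    PowerSeries.coeff (k + 1) (PowerSeries.binomialSeries ℂ (1 / (p : ℚ)))

/-- The change of normal ordering from the oscillator ordering `⦂ ⦂` (vacuum of the `λ`-plane,
`ζ = λ ^ p`) to `: :` (vacuum of the `ζ`-plane): with `ζ' = ζ (1 + ε)` and `λ' = λ (1 + ε) ^ (1/p)`,
`:exp (φ_a(ζ') - φ_a(ζ)): = orderingFactor p * ⦂exp (φ_a(ζ') - φ_a(ζ))⦂`, the factor being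
`(ζ' - ζ) (dλ'/dζ') ^ (1/2) (dλ/dζ) ^ (1/2) / (λ' - λ)
  = (1 / p) (1 + ε) ^ ((1 - p) / (2 p)) * ε / ((1 + ε) ^ (1 / p) - 1)`,
which is the exponential of one half of the double integral from `ζ` to `ζ'` of
`∂_1 ∂_2 (log (λ_1 - λ_2) - log (ζ_1 - ζ_2))`. -/
def orderingFactor (p : ℕ) : PowerSeries ℂ :=
  PowerSeries.C (1 / (p : ℂ)) *
    PowerSeries.binomialSeries ℂ ((1 - (p : ℚ)) / (2 * p)) * (rootQuotient p)⁻¹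

lemma coeff_creators_eq_zero (b : ℕ+ →₀ ℂ) (n : ℕ) (hb : b n.succPNat = 0) (Ψ : FockState)
    (l : List ℤ) (hl : ∀ x ∈ l, x < 0) (hn : Int.negSucc n ∈ l) (γ : ℕ+ →₀ ℕ)
    (hγ : γ n.succPNat = 0) :
    MvPowerSeries.coeff γ ((l.map (alpha b)).prod Ψ) = 0 := by
  induction l generalizing γ with
  | nil => simp at hn
  | cons x l ih =>
    obtain ⟨k, rfl⟩ := Int.eq_negSucc_of_lt_zero (hl x (by simp))
    have key : ∀ G : FockState, MvPowerSeries.coeff γ (alpha b (Int.negSucc k) G) =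
        ((k + 1 : ℕ) : GSeries) * (HahnSeries.single (-1 : ℤ) (b k.succPNat) *
          MvPowerSeries.coeff γ G + MvPowerSeries.coeff γ (MvPowerSeries.X k.succPNat * G)) := by
      intro G
      have hc : (((k + 1 : ℕ) : FockState)) = MvPowerSeries.C ((k + 1 : ℕ) : GSeries) := by simp
      simp only [alpha, Algebra.lmul, AlgHom.coe_mk]
      change MvPowerSeries.coeff γ ((((k + 1 : ℕ) : FockState) * _) * G) = _
      rw [hc, mul_assoc, add_mul, MvPowerSeries.coeff_C_mul, map_add, MvPowerSeries.coeff_C_mul]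
    rw [List.map_cons, List.prod_cons, Module.End.mul_apply, key]
    have hX : ∀ G : FockState, (k = n ∨ ∀ δ : ℕ+ →₀ ℕ, δ n.succPNat = 0 →
        MvPowerSeries.coeff δ G = 0) →
        MvPowerSeries.coeff γ (MvPowerSeries.X k.succPNat * G) = 0 := by
      intro G hG
      classical
      rw [MvPowerSeries.X, MvPowerSeries.coeff_monomial_mul]
      split_ifs with hle
      · rcases hG with rfl | hG
        · have := hle k.succPNat
          simp [hγ] at this
        · rw [hG _ (by simp [hγ]), mul_zero]
      · rfl
    by_cases hkn : k = n
    · subst hkn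
      rw [hX _ (Or.inl rfl), hb]
      simp
    · have hmem : Int.negSucc n ∈ l := by
        rcases List.mem_cons.1 hn with h | h
        · exact absurd (Int.negSucc_inj.1 h).symm hkn
        · exact h
      have ih' := ih (fun x hx => hl x (List.mem_cons_of_mem _ hx)) hmem
      rw [hX _ (Or.inr ih'), ih' γ hγ]
      simp

/-- Only finitely many tuples of modes contribute to a given coefficient of a current mode. -/
lemma finite_support_currentMode (b : ℕ+ →₀ ℂ) (Φ : FockState) (γ : ℕ+ →₀ ℕ) (r : ℕ) (N : ℤ) :
    {m : Fin r → ℤ | ∑ i, m i = N ∧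
      MvPowerSeries.coeff γ (normalProd b m Φ) ≠ 0}.Finite := by
  set B : ℕ := (b.support ∪ γ.support).sup (fun n => (n : ℕ)) with hB
  have hlow : ∀ m : Fin r → ℤ, MvPowerSeries.coeff γ (normalProd b m Φ) ≠ 0 →
      ∀ i, -(B : ℤ) ≤ m i := by
    intro m hm i
    by_contra hlt
    apply hm
    obtain ⟨n, hn⟩ := Int.eq_negSucc_of_lt_zero (show m i < 0 by omega)
    have hnot : n.succPNat ∉ b.support ∪ γ.support := by
      intro hmem
      have := Finset.le_sup (f := fun n : ℕ+ => (n : ℕ)) hmem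
      simp only [Nat.succPNat_coe] at this
      omega
    rw [Finset.mem_union, not_or, Finsupp.notMem_support_iff, Finsupp.notMem_support_iff] at hnot
    rw [normalProd, Module.End.mul_apply]
    refine coeff_creators_eq_zero b n hnot.1 _ _ ?_ ?_ γ hnot.2
    · intro x hx
      simpa using (List.mem_filter.1 hx).2
    · rw [List.mem_filter]
      refine ⟨?_, by simp⟩
      rw [← hn]
      exact (List.mem_ofFn' _ _).2 ⟨i, rfl⟩
  refine (Set.finite_Icc (fun _ : Fin r => -(B : ℤ)) (fun _ => N + r * B)).subset ?_
  rintro m ⟨hsum, hm⟩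
  refine ⟨fun i => hlow m hm i, fun i => ?_⟩
  have h1 : m i + B ≤ ∑ j, (m j + B) :=
    Finset.single_le_sum (f := fun j => m j + (B : ℤ))
      (fun j _ => by have := hlow m hm j; omega) (Finset.mem_univ i)
  rw [Finset.sum_add_distrib, hsum] at h1
  simp only [Finset.sum_const, Finset.card_univ, Fintype.card_fin, nsmul_eq_mul] at h1
  have : (0 : ℤ) ≤ B := by positivity
  show m i ≤ N + r * B
  linarith

/-- The coefficient of `ζ ^ (-N / p - s)` in the current
`𝓦_a^s(ζ) = :exp (-φ_a(ζ)) ∂_ζ ^ s exp (φ_a(ζ)):`, applied to `Φ`. As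
`𝓦_a^s(ζ) = ∂_{ζ'} ^ s :exp (φ_a(ζ') - φ_a(ζ)):` at `ζ' = ζ`, the current is
`s! ζ ^ (-s)` times the coefficient of `ε ^ s` in
`orderingFactor p * ∑_r (1 / r!) ⦂(∑_n phiIncrement p a n ζ ^ (-n / p) α_n) ^ r⦂`,
in which only `r ≤ s` contributes. For each monomial in the sources only finitely many
`m` contribute to the inner sum, see `finite_support_currentMode`. -/
def currentMode (p : ℕ) (b : ℕ+ →₀ ℂ) (a s : ℕ) (N : ℤ) (Φ : FockState) : FockState :=
  fun γ => ∑ r ∈ Finset.range (s + 1), ∑ᶠ (m : Fin r → ℤ) (_ : ∑ i, m i = N),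
    ((s.factorial : ℂ) / (r.factorial : ℂ) *
      PowerSeries.coeff s (orderingFactor p * ∏ i, phiIncrement p a (m i))) •
        MvPowerSeries.coeff γ (normalProd b m Φ)

/-- `W_n^s`, the coefficient of `ζ ^ (-n - s)` in `W^s(ζ) = ∑_a 𝓦_a^s(ζ)`, applied to `Φ`. -/
def wMode (p : ℕ) (b : ℕ+ →₀ ℂ) (s : ℕ) (n : ℤ) (Φ : FockState) : FockState :=
  ∑ a ∈ Finset.range p, currentMode p b a s (n * p) Φ

/-- The `W_{1+∞}` constraints `W_n^s |Φ⟩ = 0` for `s ≥ 1` and `n ≥ -s + 1`. -/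
def WConstraints (p : ℕ) (b : ℕ+ →₀ ℂ) (Φ : FockState) : Prop :=
  ∀ s : ℕ, 1 ≤ s → ∀ n : ℤ, -(s : ℤ) + 1 ≤ n → wMode p b s n Φ = 0

/-! ### Disk amplitudes -/

lemma alpha_negSucc_vev (b : ℕ+ →₀ ℂ) (Φ : FockState) (n : ℕ) (hb : b n.succPNat = 0) :
    vev Φ (alpha b (Int.negSucc n) Φ) = 0 := by
  simp [vev, alpha, hb]

/-- The coefficient of `z ^ k = ζ ^ (-k / p)` in the part of order `g ^ (-1)` of `⟨∂φ_a(ζ)⟩`. -/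
def diskCoeff (p : ℕ) (b : ℕ+ →₀ ℂ) (Φ : FockState) (a : ℕ) (k : ℤ) : ℂ :=
  phiCoeff p a (k - p) * (vev Φ (alpha b (k - p) Φ)).coeff (-1)

lemma bddBelow_support_diskCoeff (p : ℕ) (b : ℕ+ →₀ ℂ) (Φ : FockState) (a : ℕ) :
    BddBelow (Function.support (diskCoeff p b Φ a)) := by
  refine ⟨p - ((b.support.sup (fun n => (n : ℕ)) : ℕ) : ℤ), fun k hk => ?_⟩
  by_contra hlt
  apply hk
  obtain ⟨n, hn⟩ : ∃ n : ℕ, k - p = Int.negSucc n :=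
    Int.eq_negSucc_of_lt_zero (by omega)
  have hb : b n.succPNat = 0 := by
    by_contra hne
    have := Finset.le_sup (f := fun n : ℕ+ => (n : ℕ)) (Finsupp.mem_support_iff.2 hne)
    simp only [Nat.succPNat_coe] at this
    omega
  simp [diskCoeff, hn, alpha_negSucc_vev b Φ n hb]

/-- The genus zero disk amplitude `Q_a(ζ) = ⟨∂φ_a(ζ)⟩^{(0)}`, the part of order `g ^ (-1)` of
`⟨∂φ_a(ζ)⟩ = ∑_h g ^ (2 h - 1) ⟨∂φ_a(ζ)⟩^{(h)}`, expanded around `ζ = ∞`. -/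
def disk (p : ℕ) (b : ℕ+ →₀ ℂ) (Φ : FockState) (a : ℕ) : ZSeries :=
  HahnSeries.ofSuppBddBelow (diskCoeff p b Φ a) (bddBelow_support_diskCoeff p b Φ a)

/-! ### Polynomial parts, Schur polynomials, the algebraic curve -/

/-- Polynomials in `ζ` as Laurent series in `z = ζ ^ (-1 / p)`. -/
def zetaHom (p : ℕ) : Polynomial ℂ →+* ZSeries :=
  (Polynomial.aeval (HahnSeries.single (-(p : ℤ)) (1 : ℂ) : ZSeries)).toRingHom

/-- The polynomial part `[f]_pol = ∑_{l ≥ 0} c_{lp} ζ ^ l` of `f = ∑_n c_n ζ ^ (n / p)`. -/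
def polPart (p : ℕ) (f : ZSeries) : Polynomial ℂ :=
  ∑ l ∈ Finset.range ((-f.order).toNat + 1), Polynomial.monomial l (f.coeff (-((l : ℤ) * p)))

lemma coeff_polPart {p : ℕ} (hp : 0 < p) (f : ZSeries) (l : ℕ) :
    (polPart p f).coeff l = f.coeff (-((l : ℤ) * p)) := by
  simp only [polPart, Polynomial.finsetSum_coeff, Polynomial.coeff_monomial,
    Finset.sum_ite_eq', Finset.mem_range]
  split_ifs with h
  · rfl
  · refine (HahnSeries.coeff_eq_zero_of_lt_order ?_).symm
    have : (l : ℤ) ≤ l * p := by nlinarith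
    omega

/-- The Schur polynomials `𝓢_k(x)` in `x = (x_1, x_2, …)`, defined by
`exp (∑_{s ≥ 1} x_s λ ^ s) = ∑_k 𝓢_k(x) λ ^ k`. -/
def schur {R : Type*} [CommRing R] [Algebra ℚ R] (x : ℕ → R) (k : ℕ) : R :=
  PowerSeries.coeff k ((PowerSeries.exp ℚ).subst
    (PowerSeries.mk fun s => if s = 0 then 0 else x s) : PowerSeries R)

/-- The polynomials `a_s(ζ) = (p / s) [Q_0 ^ s]_pol`. -/
def aPoly (p : ℕ) (b : ℕ+ →₀ ℂ) (Φ : FockState) (s : ℕ) : Polynomial ℂ :=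
  ((p : ℂ) / (s : ℂ)) • polPart p (disk p b Φ 0 ^ s)

/-- `F(ζ, Q) = ∑_{k=0}^p Q ^ (p - k) 𝓢_k(-a(ζ))`, a polynomial in `Q` over the polynomials
in `ζ`. -/
def curve (p : ℕ) (b : ℕ+ →₀ ℂ) (Φ : FockState) : Polynomial (Polynomial ℂ) :=
  ∑ k ∈ Finset.range (p + 1),
    Polynomial.C (schur (fun s => -aPoly p b Φ s) k) * Polynomial.X ^ (p - k)

end

end MinimalString

open MinimalString

/-! The genus expansion turns the quantum constraints into identities between classical power sums,
and Newton's identities turn those into the curve.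

Write `Φ` as a constant times `exp F`. The coefficient of `F` at `β` starts at order `|β| - 2` in
`g`. Hence `α_n` acts on `H * Φ` as multiplication of `H` by a symbol `J_n`, which is `∂F/∂j_n` for
`n > 0` and the creation factor for `n < 0`, up to the term where the derivative hits `H`. That term
is of higher order in `g`, because a derivative removes a source without supplying a factor `1/g`
(`exists_symbol`, `exists_leading_symbol`). So a normal ordered product of `r` oscillators has
expectation value of order `g ^ (-r)`, with the product of the one point functions as leading
coefficient (`vev_normalProd`).

The current `𝓦_a^s` contains products of at most `s` oscillators, so at order `g ^ (-s)` only `r =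
s` counts. There the coefficient of `ε ^ s` is the lowest one possible: the ordering factor
contributes `1`, each increment contributes the coefficient of `∂φ_a`, and the result is `Q_a ^ s`
(`vev_currentMode`).

The constraints therefore remove the negative integer powers of `ζ` from `∑_a Q_a ^ s`, and
averaging over the branches removes the fractional ones. What remains is `p [Q_0 ^ s]_pol`
(`sum_disk_pow`). The polynomials `𝓢_k(-a)` obey the same recursion as the signed elementary
symmetric functions of the `Q_a` (`map_schur_eq_esymm`), and Vieta's formula gives the curve. -/

namespace MinimalString

/-! ### Exponentials of power series -/

section Exponential

variable {σ S : Type*} [CommRing S] [Algebra ℚ S]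

/-- The coefficients of `exp F` are those of a truncation of the exponential series. -/
lemma coeff_exp_subst {F : MvPowerSeries σ S} (hF : MvPowerSeries.constantCoeff F = 0)
    (e : σ →₀ ℕ) {M : ℕ} (hM : e.degree < M) :
    MvPowerSeries.coeff e ((PowerSeries.exp ℚ).subst F) =
      ∑ d ∈ Finset.range M, (1 / (d.factorial : ℚ)) • MvPowerSeries.coeff e (F ^ d) := by
  rw [PowerSeries.coeff_subst (PowerSeries.HasSubst.of_constantCoeff_zero hF)]
  rw [finsum_eq_sum_of_support_subset (s := Finset.range M)]
  · exact Finset.sum_congr rfl fun d _ => by simp [PowerSeries.coeff_exp]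
  · intro d hd
    by_contra hlt
    apply hd
    simp only [Finset.coe_range, Set.mem_Iio, not_lt] at hlt
    have : MvPowerSeries.coeff e (F ^ d) = 0 := by
      apply MvPowerSeries.coeff_of_lt_order
      refine lt_of_lt_of_le ?_ (MvPowerSeries.le_order_pow_of_constantCoeff_eq_zero d hF)
      exact_mod_cast hM.trans_le hlt
    simp [this]

lemma constantCoeff_exp_subst {F : MvPowerSeries σ S} (hF : MvPowerSeries.constantCoeff F = 0) :
    MvPowerSeries.constantCoeff ((PowerSeries.exp ℚ).subst F : MvPowerSeries σ S) = 1 := by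
  rw [← MvPowerSeries.coeff_zero_eq_constantCoeff_apply,
    coeff_exp_subst hF 0 (M := 1) (by simp)]
  simp

/-- The chain rule for `exp F`. -/
lemma pderiv_exp_subst {F : MvPowerSeries σ S} (hF : MvPowerSeries.constantCoeff F = 0) (i : σ) :
    MvPowerSeries.pderiv S i ((PowerSeries.exp ℚ).subst F) =
      MvPowerSeries.pderiv S i F * (PowerSeries.exp ℚ).subst F := by
  classical
  ext e
  -- Differentiation reads `exp F` one degree higher, so one more term of the exponential is kept on
  -- the left. Its `d = 0` term has derivative zero, and shifting `d` aligns the two sums.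
  have hM : (e + Finsupp.single i 1).degree < e.degree + 1 + 1 := by simp
  have h1 : MvPowerSeries.coeff e (MvPowerSeries.pderiv S i ((PowerSeries.exp ℚ).subst F)) =
      ∑ d ∈ Finset.range (e.degree + 1 + 1), (1 / (d.factorial : ℚ)) •
        MvPowerSeries.coeff e (MvPowerSeries.pderiv S i (F ^ d)) := by
    rw [MvPowerSeries.coeff_pderiv, coeff_exp_subst hF _ hM, Finset.sum_mul]
    refine Finset.sum_congr rfl fun d _ => ?_
    rw [MvPowerSeries.coeff_pderiv, smul_mul_assoc]
  rw [h1, Finset.sum_range_succ', MvPowerSeries.coeff_mul]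
  have h2 : ∀ x ∈ Finset.HasAntidiagonal.antidiagonal e,
      MvPowerSeries.coeff x.1 (MvPowerSeries.pderiv S i F) *
        MvPowerSeries.coeff x.2 ((PowerSeries.exp ℚ).subst F) =
      ∑ d ∈ Finset.range (e.degree + 1), (1 / (d.factorial : ℚ)) •
        (MvPowerSeries.coeff x.1 (MvPowerSeries.pderiv S i F) *
          MvPowerSeries.coeff x.2 (F ^ d)) := by
    intro x hx
    have hle : x.2.degree < e.degree + 1 := by
      rw [← Finset.HasAntidiagonal.mem_antidiagonal.1 hx, map_add]
      omega
    rw [coeff_exp_subst hF _ hle, Finset.mul_sum]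
    exact Finset.sum_congr rfl fun d _ => by rw [mul_smul_comm]
  rw [Finset.sum_congr rfl h2, Finset.sum_comm]
  simp only [pow_zero, MvPowerSeries.pderiv_one, map_zero, smul_zero, add_zero]
  refine Finset.sum_congr rfl fun d _ => ?_
  rw [← Finset.smul_sum, ← MvPowerSeries.coeff_mul, Derivation.leibniz_pow, smul_eq_mul,
    add_tsub_cancel_right, map_nsmul, mul_comm (F ^ d), ← Nat.cast_smul_eq_nsmul ℚ, smul_smul]
  congr 1
  rw [Nat.factorial_succ]
  have : (d.factorial : ℚ) ≠ 0 := by positivity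
  push_cast
  field_simp

end Exponential

/-! ### Schur polynomials and Newton's identities -/

section Newton

variable {R : Type*} [CommRing R]

lemma schur_zero [Algebra ℚ R] (x : ℕ → R) : schur x 0 = 1 := by
  rw [schur, PowerSeries.coeff_zero_eq_constantCoeff_apply]
  exact constantCoeff_exp_subst (σ := Unit)
    (F := (PowerSeries.mk fun s => if s = 0 then 0 else x s : PowerSeries R))
    (by
      change PowerSeries.constantCoeff _ = _
      simp)

/-- Coefficient of `λ ^ k` in `E' = G' E` for `E = exp G`, with power series viewed as series in one
variable indexed by `Unit`. -/
lemma succ_mul_schur [Algebra ℚ R] (x : ℕ → R) (k : ℕ) :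
    ((k : R) + 1) * schur x (k + 1) =
      ∑ ij ∈ Finset.HasAntidiagonal.antidiagonal k, ((ij.1 : R) + 1) * x (ij.1 + 1) * schur x ij.2 := by
  set G : PowerSeries R := PowerSeries.mk fun s => if s = 0 then 0 else x s with hG
  have hG0 : MvPowerSeries.constantCoeff G = 0 := by
    change PowerSeries.constantCoeff _ = _
    simp [hG]
  have hd : ∀ (f : PowerSeries R) (n : ℕ),
      PowerSeries.coeff n (MvPowerSeries.pderiv R () f : PowerSeries R) =
        PowerSeries.coeff (n + 1) f * ((n : R) + 1) := by
    intro f n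
    rw [PowerSeries.coeff, MvPowerSeries.coeff_pderiv, PowerSeries.coeff, ← Finsupp.single_add]
    simp
  have h := congrArg (PowerSeries.coeff k) (pderiv_exp_subst (σ := Unit) hG0 ())
  rw [hd] at h
  rw [mul_comm]
  refine h.trans ?_
  refine (PowerSeries.coeff_mul k _ _).trans (Finset.sum_congr rfl fun ij _ => ?_)
  rw [hd, schur]
  simp [hG, mul_comm]

/-- Newton's identities for the signed elementary symmetric functions. -/
lemma succ_mul_neg_one_pow_mul_esymm {ι : Type*} [Fintype ι] (f : ι → R) (k : ℕ) :
    ((k : R) + 1) * ((-1) ^ (k + 1) * (Finset.univ.val.map f).esymm (k + 1)) =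
      ∑ ij ∈ Finset.HasAntidiagonal.antidiagonal k, -(∑ i, f i ^ (ij.1 + 1)) *
        ((-1) ^ ij.2 * (Finset.univ.val.map f).esymm ij.2) := by
  have h := congrArg (MvPolynomial.aeval f) (MvPolynomial.mul_esymm_eq_sum ι R (k + 1))
  simp only [map_mul, map_sum, map_pow, map_neg, map_one, map_natCast, MvPolynomial.psum,
    MvPolynomial.aeval_esymm_eq_multiset_esymm, MvPolynomial.aeval_X] at h
  -- The excluded pair would carry the zeroth power sum; the others have a positive power sum index,
  -- which is written as a successor.
  have hset : (Finset.HasAntidiagonal.antidiagonal (k + 1)).filter (fun a => a.1 < k + 1) =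
      (Finset.HasAntidiagonal.antidiagonal k).map
        ((Function.Embedding.refl ℕ).prodMap ⟨Nat.succ, Nat.succ_injective⟩) := by
    ext ⟨i, j⟩
    simp only [Finset.mem_filter, Finset.HasAntidiagonal.mem_antidiagonal, Finset.mem_map, Prod.exists,
      Function.Embedding.coe_prodMap, Prod.map_apply, Function.Embedding.refl_apply,
      Function.Embedding.coeFn_mk, Prod.mk.injEq]
    constructor
    · rintro ⟨h1, h2⟩
      exact ⟨i, j - 1, by omega, rfl, by omega⟩
    · rintro ⟨i, j, h1, rfl, rfl⟩
      omega
  rw [hset, Finset.sum_map] at h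
  push_cast at h
  rw [mul_left_comm, h, ← mul_assoc, ← Finset.Nat.sum_antidiagonal_swap, Finset.mul_sum]
  refine Finset.sum_congr rfl fun ij _ => ?_
  have h1 : ((-1 : R) ^ (k + 1) * (-1) ^ (k + 1 + 1)) = -1 := by
    rw [pow_succ _ (k + 1), ← mul_assoc, ← mul_pow]
    simp
  rw [h1]
  simp
  ring

/-- The Schur polynomials in `-p_s / s`, `p_s` the power sums, are the signed elementary symmetric
functions. -/
lemma map_schur_eq_esymm [Algebra ℚ R] {A : Type*} [CommRing A] [IsDomain A] [CharZero A]
    (φ : R →+* A) {ι : Type*} [Fintype ι] (f : ι → A) (x : ℕ → R)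
    (hx : ∀ s : ℕ, 1 ≤ s → ∑ i, f i ^ s = (s : A) * φ (x s)) (k : ℕ) :
    φ (schur (fun s => -x s) k) = (-1) ^ k * (Finset.univ.val.map f).esymm k := by
  induction k using Nat.strong_induction_on with
  | _ k ih =>
    rcases k with _ | k
    · simp [schur_zero, Multiset.esymm]
    · have hk : ((k : A) + 1) ≠ 0 := by exact_mod_cast k.succ_ne_zero
      refine mul_left_cancel₀ hk ?_
      rw [succ_mul_neg_one_pow_mul_esymm]
      have h := congrArg φ (succ_mul_schur (fun s => -x s) k)
      simp only [map_mul, map_add, map_natCast, map_one, map_sum, map_neg] at h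
      rw [h]
      refine Finset.sum_congr rfl fun ij hij => ?_
      have := Finset.HasAntidiagonal.mem_antidiagonal.1 hij
      rw [ih ij.2 (by omega), hx _ (by omega)]
      push_cast
      ring

end Newton

/-! ### Leading coefficients of Laurent series -/

section Laurent

/-- The coefficients of `x` below `L` vanish. -/
def VanishesBelow (x : LaurentSeries ℂ) (L : ℤ) : Prop :=
  ∀ k < L, x.coeff k = 0

lemma VanishesBelow.mono {x : LaurentSeries ℂ} {L L' : ℤ} (hx : VanishesBelow x L)
    (h : L' ≤ L) : VanishesBelow x L' :=
  fun k hk => hx k (hk.trans_le h)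

lemma VanishesBelow.add {x y : LaurentSeries ℂ} {L : ℤ} (hx : VanishesBelow x L)
    (hy : VanishesBelow y L) : VanishesBelow (x + y) L :=
  fun k hk => by rw [HahnSeries.coeff_add, hx k hk, hy k hk, add_zero]

lemma VanishesBelow.mul {x y : LaurentSeries ℂ} {L M : ℤ} (hx : VanishesBelow x L)
    (hy : VanishesBelow y M) : VanishesBelow (x * y) (L + M) := by
  intro k hk
  rw [HahnSeries.coeff_mul]
  refine Finset.sum_eq_zero fun ij hij => ?_
  have h := (Finset.mem_antidiagonal.1 hij).2.2
  rcases lt_or_ge ij.1 L with h1 | h1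
  · rw [hx _ h1, zero_mul]
  · rw [hy _ (by omega), mul_zero]

lemma VanishesBelow.coeff_mul {x y : LaurentSeries ℂ} {L M : ℤ} (hx : VanishesBelow x L)
    (hy : VanishesBelow y M) : (x * y).coeff (L + M) = x.coeff L * y.coeff M := by
  rw [HahnSeries.coeff_mul]
  refine Finset.sum_eq_single (L, M) (fun ij hij hne => ?_) (fun h => ?_)
  · have h := (Finset.mem_antidiagonal.1 hij).2.2
    rcases lt_trichotomy ij.1 L with h1 | h1 | h1
    · rw [hx _ h1, zero_mul]
    · exact absurd (Prod.ext h1 (by simp only; omega)) hne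
    · rw [hy _ (by omega), mul_zero]
  · by_contra h0
    exact h (Finset.mem_antidiagonal.2
      ⟨fun h1 => h0 (by simp [h1]), fun h1 => h0 (by simp [h1]), rfl⟩)

lemma vanishesBelow_one : VanishesBelow 1 0 := by
  intro k hk
  rw [HahnSeries.coeff_one, if_neg hk.ne]

lemma VanishesBelow.prod {ι : Type*} (s : Finset ι) {x : ι → LaurentSeries ℂ} {L : ℤ}
    (hx : ∀ i ∈ s, VanishesBelow (x i) L) :
    VanishesBelow (∏ i ∈ s, x i) (s.card * L) ∧
      (∏ i ∈ s, x i).coeff (s.card * L) = ∏ i ∈ s, (x i).coeff L := by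
  classical
  induction s using Finset.induction_on with
  | empty => simpa using vanishesBelow_one
  | insert i s hi ih =>
    obtain ⟨h1, h2⟩ := ih fun j hj => hx j (Finset.mem_insert_of_mem hj)
    have h3 := hx i (Finset.mem_insert_self i s)
    have h4 : ((insert i s).card : ℤ) * L = L + s.card * L := by
      rw [Finset.card_insert_of_notMem hi]
      push_cast
      ring
    rw [Finset.prod_insert hi, Finset.prod_insert hi, h4]
    exact ⟨h3.mul h1, by rw [h3.coeff_mul h1, h2]⟩

/-- The difference is `x - y` times a sum of monomials of degree `r` in `x` and `y`. This controls
the error when a series is replaced by a finite truncation. -/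
lemma VanishesBelow.pow_succ_sub {x y : LaurentSeries ℂ} {L M : ℤ} (hx : VanishesBelow x L)
    (hy : VanishesBelow y L) (hxy : VanishesBelow (x - y) M) (r : ℕ) :
    VanishesBelow (x ^ (r + 1) - y ^ (r + 1)) (M + r * L) := by
  have hyp : ∀ n : ℕ, VanishesBelow (y ^ n) (n * L) := fun n => by
    simpa using (VanishesBelow.prod (Finset.range n) (fun _ _ => hy)).1
  induction r with
  | zero => simpa using hxy
  | succ r ih =>
    have h : x ^ (r + 1 + 1) - y ^ (r + 1 + 1) =
        x * (x ^ (r + 1) - y ^ (r + 1)) + (x - y) * y ^ (r + 1) := by ring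
    rw [h]
    exact ((hx.mul ih).mono (by push_cast; linarith)).add (hxy.mul (hyp (r + 1)))

lemma exists_vanishesBelow (x : LaurentSeries ℂ) : ∃ L, VanishesBelow x L :=
  ⟨x.order, fun _ hk => HahnSeries.coeff_eq_zero_of_lt_order hk⟩

/-- The coefficients of a power of a Laurent series. -/
lemma coeff_pow_eq_finsum (x : LaurentSeries ℂ) (r : ℕ) (N : ℤ) :
    (x ^ r).coeff N = ∑ᶠ m ∈ {m : Fin r → ℤ | ∑ i, m i = N}, ∏ i, x.coeff (m i) := by
  classical
  obtain ⟨L, hL⟩ := exists_vanishesBelow x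
  rcases r with _ | r
  · rw [pow_zero, HahnSeries.coeff_one, finsum_mem_eq_sum_of_subset
      (t := if N = 0 then Finset.univ else ∅)]
    · split_ifs <;> simp
    · rintro m ⟨h, -⟩
      have : N = 0 := by simpa using h.symm
      simp only [this, if_true, Finset.coe_univ, Set.mem_univ]
    · intro m hm
      split_ifs at hm with h
      · simp [h]
      · simp at hm
  -- If `r + 1` integers, all at least `L`, sum to `N`, then none exceeds `U`. Truncating `x` to
  -- `[L, U]` changes its power only from exponent `U + 1 + r * L = N + 1` on.
  set U : ℤ := N - r * L with hU
  set y : LaurentSeries ℂ := ∑ k ∈ Finset.Icc L U, HahnSeries.single k (x.coeff k) with hy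
  have hyc : ∀ k, y.coeff k = if k ∈ Finset.Icc L U then x.coeff k else 0 := by
    intro k
    rw [hy, HahnSeries.coeff_sum]
    simp only [HahnSeries.coeff_single]
    convert Finset.sum_ite_eq (Finset.Icc L U) k x.coeff
  have hyL : VanishesBelow y L := fun k hk => by
    rw [hyc, if_neg (by simp [hk])]
  have hxy : VanishesBelow (x - y) (U + 1) := by
    intro k hk
    rw [HahnSeries.coeff_sub, hyc]
    split_ifs with h
    · exact sub_self _
    · rw [hL k (by simp at h; omega), sub_zero]
  have h1 : (x ^ (r + 1)).coeff N = (y ^ (r + 1)).coeff N := by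
    have h := hL.pow_succ_sub hyL hxy r N (by rw [hU]; linarith)
    rwa [HahnSeries.coeff_sub, sub_eq_zero] at h
  have h2 : y ^ (r + 1) = ∑ m ∈ Fintype.piFinset fun _ : Fin (r + 1) => Finset.Icc L U,
      HahnSeries.single (∑ i, m i) (∏ i, x.coeff (m i)) := by
    have h3 : y ^ (r + 1) = ∏ _i : Fin (r + 1), y := by simp
    rw [h3, hy, Finset.prod_univ_sum]
    refine Finset.sum_congr rfl fun m _ => ?_
    have key : ∀ s : Finset (Fin (r + 1)),
        ∏ i ∈ s, (HahnSeries.single (m i) (x.coeff (m i)) : LaurentSeries ℂ) =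
          HahnSeries.single (∑ i ∈ s, m i) (∏ i ∈ s, x.coeff (m i)) := by
      intro s
      induction s using Finset.induction_on with
      | empty => simp
      | insert i s hi ih =>
        rw [Finset.prod_insert hi, ih, HahnSeries.single_mul_single, Finset.sum_insert hi,
          Finset.prod_insert hi]
    exact key _
  rw [h1, h2, HahnSeries.coeff_sum]
  rw [finsum_mem_eq_sum_of_subset (t := (Fintype.piFinset fun _ : Fin (r + 1) =>
    Finset.Icc L U).filter fun m => ∑ i, m i = N), Finset.sum_filter]
  · refine Finset.sum_congr rfl fun m _ => ?_
    by_cases h : ∑ i, m i = N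
    · rw [if_pos h, h, HahnSeries.coeff_single_same]
    · rw [if_neg h, HahnSeries.coeff_single_of_ne (Ne.symm h)]
  · rintro m ⟨hm, hne⟩
    have hm' : ∑ i, m i = N := hm
    have hlow : ∀ i, L ≤ m i := by
      intro i
      by_contra hlt
      exact hne (Finset.prod_eq_zero (Finset.mem_univ i) (hL _ (by omega)))
    simp only [Finset.coe_filter, Fintype.mem_piFinset, Finset.mem_Icc, Set.mem_ofPred_eq]
    refine ⟨fun i => ⟨hlow i, ?_⟩, hm'⟩
    have h3 : m i - L ≤ ∑ j, (m j - L) :=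
      Finset.single_le_sum (f := fun j => m j - L)
        (fun j _ => sub_nonneg.2 (hlow j)) (Finset.mem_univ i)
    rw [Finset.sum_sub_distrib, hm'] at h3
    simp only [Finset.sum_const, Finset.card_univ, Fintype.card_fin, nsmul_eq_mul] at h3
    push_cast at h3
    linarith
  · intro m hm
    exact (Finset.mem_filter.1 hm).2

end Laurent

/-! ### Oscillators at leading order in the string coupling -/

section Genus

/-- The power series in the sources whose coefficient at `β` is of order at least `|β| - k`
in the string coupling. -/
def couplingFiltration (k : ℤ) : AddSubgroup FockState where
  carrier := {H | ∀ β : ℕ+ →₀ ℕ, VanishesBelow (MvPowerSeries.coeff β H) (β.degree - k)}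
  zero_mem' := fun β m _ => by simp
  add_mem' := fun {H K} hH hK β => by
    rw [map_add]
    exact (hH β).add (hK β)
  neg_mem' := fun {H} hH β m hm => by
    rw [map_neg, HahnSeries.coeff_neg, hH β m hm, neg_zero]

lemma couplingFiltration_mono {k l : ℤ} (h : k ≤ l) :
    couplingFiltration k ≤ couplingFiltration l :=
  fun _ hH β => (hH β).mono (by omega)

lemma mul_mem_couplingFiltration {k l : ℤ} {H K : FockState} (hH : H ∈ couplingFiltration k)
    (hK : K ∈ couplingFiltration l) : H * K ∈ couplingFiltration (k + l) := by
  classical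
  intro β m hm
  rw [MvPowerSeries.coeff_mul, HahnSeries.coeff_sum]
  refine Finset.sum_eq_zero fun ij hij => ?_
  have hij' := congrArg Finsupp.degree (Finset.HasAntidiagonal.mem_antidiagonal.1 hij)
  rw [map_add] at hij'
  refine ((hH ij.1).mul (hK ij.2)) m (hm.trans_le ?_)
  rw [← hij']
  push_cast
  linarith

lemma one_mem_couplingFiltration : (1 : FockState) ∈ couplingFiltration 0 := by
  classical
  intro β m hm
  rw [MvPowerSeries.coeff_one]
  split_ifs with h
  · subst h
    exact vanishesBelow_one m (by simpa using hm)
  · simp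

/-- The coefficient at `β` comes from a monomial of degree `|β| + 1`, and the integer factor has
order `0` in `g`. -/
lemma pderiv_mem_couplingFiltration {k : ℤ} {H : FockState} (hH : H ∈ couplingFiltration k)
    (n : ℕ+) : MvPowerSeries.pderiv GSeries n H ∈ couplingFiltration (k - 1) := by
  intro β
  rw [MvPowerSeries.coeff_pderiv]
  have h1 : VanishesBelow ((β n : GSeries) + 1) 0 := by
    intro m hm
    have : ((β n : GSeries) + 1) = HahnSeries.C ((β n : ℂ) + 1) := by
      rw [map_add, map_natCast, map_one]
    rw [this, HahnSeries.C_apply, HahnSeries.coeff_single_of_ne hm.ne]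
  refine ((hH _).mul h1).mono ?_
  simp

/-- The factor by which `α_n` multiplies a state at leading order. -/
lemma exists_symbol (b : ℕ+ →₀ ℂ) {Φ : FockState} (hgenus : HasGenusExpansion Φ) (n : ℤ) :
    ∃ J ∈ couplingFiltration 1, alpha b n Φ = J * Φ ∧
      ∀ k, ∀ H ∈ couplingFiltration k, ∃ H' ∈ couplingFiltration (k - 1),
        alpha b n (H * Φ) = (J * H + H') * Φ := by
  obtain ⟨F, hF0, hF, hcoeff⟩ := hgenus
  have hF2 : F ∈ couplingFiltration 2 := by
    intro β m hm
    by_contra hne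
    obtain ⟨h, rfl⟩ := hcoeff β m hne
    omega
  match n with
  | Int.ofNat 0 =>
    exact ⟨0, zero_mem _, by simp [alpha],
      fun k H _ => ⟨0, zero_mem _, by simp [alpha]⟩⟩
  | Int.ofNat (n + 1) =>
    have hΦ : MvPowerSeries.pderiv GSeries n.succPNat Φ =
        MvPowerSeries.pderiv GSeries n.succPNat F * Φ := by
      rw [hF, Derivation.leibniz, MvPowerSeries.pderiv_C, smul_zero, add_zero,
        pderiv_exp_subst hF0, smul_eq_mul]
      ring
    refine ⟨MvPowerSeries.pderiv GSeries n.succPNat F,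
      by simpa using pderiv_mem_couplingFiltration hF2 n.succPNat, hΦ, fun k H hH =>
      -- By the Leibniz rule, the derivative on `Φ` gives the symbol and the derivative on `H` gives
      -- the correction.
      ⟨MvPowerSeries.pderiv GSeries n.succPNat H, pderiv_mem_couplingFiltration hH _, ?_⟩⟩
    change MvPowerSeries.pderiv GSeries n.succPNat (H * Φ) = _
    rw [Derivation.leibniz, hΦ, smul_eq_mul, smul_eq_mul]
    ring
  | Int.negSucc n =>
    refine ⟨((n + 1 : ℕ) : FockState) *
      (MvPowerSeries.C (HahnSeries.single (-1 : ℤ) (b n.succPNat))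
        + MvPowerSeries.X n.succPNat), ?_, rfl,
      fun k H _ => ⟨0, zero_mem _, ?_⟩⟩
    -- Both summands have index `1`: `b_n / g` has degree `0` and order `-1`, and `j_n` has degree
    -- `1` and order `0`.
    · rw [← nsmul_eq_mul]
      refine nsmul_mem (add_mem ?_ ?_) _
      · classical
        intro β m hm
        rw [MvPowerSeries.coeff_C]
        split_ifs with h
        · subst h
          rw [HahnSeries.coeff_single_of_ne]
          simp at hm
          omega
        · simp
      · classical
        intro β m hm
        rw [MvPowerSeries.coeff_X]
        split_ifs with h
        · subst h
          exact vanishesBelow_one m (by simpa using hm)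
        · simp
    · rw [add_zero, mul_assoc]
      rfl

/-- A product of oscillators acts on a state with a genus expansion, at leading order, as the
product of the symbols. -/
lemma exists_leading_symbol (b : ℕ+ →₀ ℂ) {Φ : FockState} {J : ℤ → FockState}
    (hJ : ∀ n, J n ∈ couplingFiltration 1)
    (hact : ∀ n k, ∀ H ∈ couplingFiltration k, ∃ H' ∈ couplingFiltration (k - 1),
      alpha b n (H * Φ) = (J n * H + H') * Φ) (l : List ℤ) :
    ∃ H ∈ couplingFiltration l.length, (l.map (alpha b)).prod Φ = H * Φ ∧
      H - (l.map J).prod ∈ couplingFiltration (l.length - 1) := by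
  induction l with
  | nil => exact ⟨1, one_mem_couplingFiltration, by simp, by simp [zero_mem]⟩
  | cons n l ih =>
    obtain ⟨H, hH, hHΦ, hlead⟩ := ih
    obtain ⟨H', hH', hact'⟩ := hact n _ H hH
    have hlen : ((n :: l).length : ℤ) = l.length + 1 := by simp
    refine ⟨J n * H + H', ?_, ?_, ?_⟩
    · exact add_mem (couplingFiltration_mono (by omega) (mul_mem_couplingFiltration (hJ n) hH))
        (couplingFiltration_mono (by omega) hH')
    · rw [List.map_cons, List.prod_cons, Module.End.mul_apply, hHΦ, hact']
    · rw [List.map_cons, List.prod_cons]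
      -- The old error times a symbol, plus the new correction: both have index at most `l.length`,
      -- one below the length of the extended list.
      have : J n * H + H' - J n * (l.map J).prod = J n * (H - (l.map J).prod) + H' := by ring
      rw [this]
      exact add_mem
        (couplingFiltration_mono (by omega) (mul_mem_couplingFiltration (hJ n) hlead))
        (couplingFiltration_mono (by omega) hH')

lemma vev_mul {Φ : FockState} (hΦ : MvPowerSeries.constantCoeff Φ ≠ 0) (H : FockState) :
    vev Φ (H * Φ) = MvPowerSeries.constantCoeff H := by
  rw [vev, map_mul, mul_div_cancel_right₀ _ hΦ]

/-- At leading order in the string coupling, correlation functions of normal ordered products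
factorize into one point functions. -/
lemma vev_normalProd (b : ℕ+ →₀ ℂ) {Φ : FockState}
    (hΦ : MvPowerSeries.constantCoeff Φ ≠ 0) (hgenus : HasGenusExpansion Φ) {r : ℕ}
    (m : Fin r → ℤ) :
    VanishesBelow (vev Φ (normalProd b m Φ)) (-r) ∧
      (vev Φ (normalProd b m Φ)).coeff (-r) =
        ∏ i, (vev Φ (alpha b (m i) Φ)).coeff (-1) := by
  choose J hJ hJΦ hact using exists_symbol b hgenus
  set l : List ℤ := (List.ofFn m).filter (fun n => n < 0) ++
    (List.ofFn m).filter (fun n => 0 ≤ n) with hl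
  -- Normal ordering only permutes the factors, and the symbols commute, so the leading term does
  -- not see it.
  have hperm : l.Perm (List.ofFn m) := by
    have h := List.filter_append_perm (fun n : ℤ => decide (n < 0)) (List.ofFn m)
    have h2 : (List.ofFn m).filter (fun n => !decide (n < 0)) =
        (List.ofFn m).filter (fun n => 0 ≤ n) := by
      refine List.filter_congr fun n _ => ?_
      simp [← decide_not]
    rwa [h2] at h
  have hlen : l.length = r := by rw [hperm.length_eq, List.length_ofFn]
  have hprod : (l.map J).prod = ∏ i, J (m i) := by
    rw [(hperm.map J).prod_eq, List.map_ofFn, List.prod_ofFn]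
    rfl
  obtain ⟨H, hH, hHΦ, hlead⟩ := exists_leading_symbol b hJ hact l
  have hnormal : normalProd b m Φ = H * Φ := by
    rw [← hHΦ, hl, List.map_append, List.prod_append]
    rfl
  rw [hlen, hprod] at hlead
  rw [hlen] at hH
  have hconst : ∀ {k : ℤ} {K : FockState}, K ∈ couplingFiltration k →
      VanishesBelow (MvPowerSeries.constantCoeff K) (-k) := by
    intro k K hK
    simpa using hK 0
  rw [hnormal, vev_mul hΦ]
  refine ⟨hconst hH, ?_⟩
  have h1 := hconst hlead (-r) (by omega)
  rw [map_sub, HahnSeries.coeff_sub, sub_eq_zero] at h1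
  rw [h1, map_prod]
  have h2 := (VanishesBelow.prod Finset.univ
    (fun i (_ : i ∈ Finset.univ) => hconst (hJ (m i)))).2
  simp only [Finset.card_univ, Fintype.card_fin, mul_neg, mul_one] at h2
  rw [h2]
  exact Finset.prod_congr rfl fun i _ => by rw [hJΦ, vev_mul hΦ]

end Genus

/-! ### The currents at leading order -/

section Currents

/-- The prefactor `1 / p` cancels the slope `1 / p` of `(1 + ε) ^ (1 / p)` at `ε = 0`. -/
lemma constantCoeff_orderingFactor {p : ℕ} (hp : 0 < p) :
    PowerSeries.constantCoeff (orderingFactor p) = 1 := by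
  have h : PowerSeries.constantCoeff (rootQuotient p) = 1 / (p : ℂ) := by
    rw [rootQuotient, ← PowerSeries.coeff_zero_eq_constantCoeff_apply, PowerSeries.coeff_mk,
      PowerSeries.binomialSeries_coeff]
    simp [Rat.smul_def]
  have hp' : (p : ℂ) ≠ 0 := by exact_mod_cast hp.ne'
  rw [orderingFactor, map_mul, map_mul, PowerSeries.constantCoeff_C,
    PowerSeries.binomialSeries_constantCoeff, PowerSeries.constantCoeff_inv, h]
  field_simp

lemma exists_phiIncrement_eq_X_mul (p a : ℕ) (n : ℤ) : ∃ f : PowerSeries ℂ,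
    phiIncrement p a n = PowerSeries.X * f ∧ PowerSeries.constantCoeff f = phiCoeff p a n := by
  obtain ⟨f, hf⟩ := PowerSeries.X_dvd_iff.2 (show PowerSeries.constantCoeff
    (phiIncrement p a n) = 0 by
      rw [← PowerSeries.coeff_zero_eq_constantCoeff_apply, phiIncrement, PowerSeries.coeff_mk])
  refine ⟨f, hf, ?_⟩
  have h := congrArg (PowerSeries.coeff 1) hf
  rw [← PowerSeries.coeff_zero_eq_constantCoeff_apply,
    ← PowerSeries.coeff_succ_X_mul, ← h, phiIncrement, PowerSeries.coeff_mk]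
  simp

/-- Each of the `s` increments is divisible by `ε`, so the coefficient of `ε ^ s` sees only leading
terms, and the change of vacuum drops out. -/
lemma coeff_orderingFactor_mul_prod {p : ℕ} (hp : 0 < p) (a : ℕ) {s : ℕ} (m : Fin s → ℤ) :
    PowerSeries.coeff s (orderingFactor p * ∏ i, phiIncrement p a (m i)) =
      ∏ i, phiCoeff p a (m i) := by
  choose f hf hf0 using exists_phiIncrement_eq_X_mul p a
  have h : orderingFactor p * ∏ i, phiIncrement p a (m i) =
      PowerSeries.X ^ s * (orderingFactor p * ∏ i, f (m i)) := by
    simp only [hf, Finset.prod_mul_distrib, Finset.prod_const, Finset.card_univ, Fintype.card_fin]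
    ring
  have h2 := PowerSeries.coeff_X_pow_mul (orderingFactor p * ∏ i, f (m i)) s 0
  rw [zero_add] at h2
  rw [h, h2, PowerSeries.coeff_zero_eq_constantCoeff_apply, map_mul,
    constantCoeff_orderingFactor hp, one_mul, map_prod]
  simp only [hf0]

/-- The coefficient of `g ^ k` in `x / ⟨b/g|Φ⟩`, as a linear functional of `x`. -/
noncomputable def vevCoeff (Φ : FockState) (k : ℤ) : GSeries →ₗ[ℂ] ℂ where
  toFun x := (x / MvPowerSeries.constantCoeff Φ).coeff k
  map_add' x y := by rw [add_div, HahnSeries.coeff_add]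
  map_smul' c x := by
    rw [← HahnSeries.C_mul_eq_smul, mul_div_assoc, HahnSeries.C_mul_eq_smul, HahnSeries.coeff_smul,
      RingHom.id_apply]

lemma coeff_vev (Φ Ψ : FockState) (k : ℤ) :
    (vev Φ Ψ).coeff k = vevCoeff Φ k (MvPowerSeries.coeff 0 Ψ) := rfl

lemma coeff_vev_currentMode (p : ℕ) (b : ℕ+ →₀ ℂ) (a s : ℕ) (N : ℤ) (Φ : FockState) (k : ℤ) :
    (vev Φ (currentMode p b a s N Φ)).coeff k =
      ∑ r ∈ Finset.range (s + 1), ∑ᶠ m ∈ {m : Fin r → ℤ | ∑ i, m i = N},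
        ((s.factorial : ℂ) / (r.factorial : ℂ) *
          PowerSeries.coeff s (orderingFactor p * ∏ i, phiIncrement p a (m i))) *
            (vev Φ (normalProd b m Φ)).coeff k := by
  rw [coeff_vev]
  change vevCoeff Φ k (currentMode p b a s N Φ 0) = _
  rw [currentMode, map_sum]
  refine Finset.sum_congr rfl fun r _ => ?_
  -- Finiteness of the contributing tuples allows the linear functional to pass through the
  -- `finsum`.
  have hfin := finite_support_currentMode b Φ 0 r N
  set t := hfin.toFinset with ht
  have hmem : ∀ m, m ∈ t ↔ ∑ i, m i = N ∧
      MvPowerSeries.coeff 0 (normalProd b m Φ) ≠ 0 := fun m => by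
    rw [ht, Set.Finite.mem_toFinset]
    rfl
  change vevCoeff Φ k (∑ᶠ m ∈ {m : Fin r → ℤ | ∑ i, m i = N}, _) = _
  rw [finsum_mem_eq_sum_of_subset (t := t), finsum_mem_eq_sum_of_subset (t := t), map_sum]
  · refine Finset.sum_congr rfl fun m _ => ?_
    rw [map_smul, smul_eq_mul, coeff_vev]
  · rintro m ⟨hm, hne⟩
    refine (hmem m).2 ⟨hm, fun h0 => hne ?_⟩
    simp only [coeff_vev, h0, map_zero, mul_zero]
  · exact fun m hm => ((hmem m).1 hm).1
  · rintro m ⟨hm, hne⟩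
    refine (hmem m).2 ⟨hm, fun h0 => hne ?_⟩
    simp only [h0, smul_zero]
  · exact fun m hm => ((hmem m).1 hm).1

lemma coeff_disk (p : ℕ) (b : ℕ+ →₀ ℂ) (Φ : FockState) (a : ℕ) (k : ℤ) :
    (disk p b Φ a).coeff k =
      phiCoeff p a (k - p) * (vev Φ (alpha b (k - p) Φ)).coeff (-1) := rfl

lemma coeff_disk_pow (p : ℕ) (b : ℕ+ →₀ ℂ) (Φ : FockState) (a s : ℕ) (N : ℤ) :
    (disk p b Φ a ^ s).coeff (N + p * s) = ∑ᶠ m ∈ {m : Fin s → ℤ | ∑ i, m i = N},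
      ∏ i, (phiCoeff p a (m i) * (vev Φ (alpha b (m i) Φ)).coeff (-1)) := by
  -- This is `ζ Q_a`: the mode `α_n` then sits at exponent `n` of `z`, and the `s` factors of `ζ`
  -- account for the shift by `p * s`.
  set x : ZSeries := HahnSeries.single (-(p : ℤ)) 1 * disk p b Φ a with hx
  have hxc : ∀ n : ℤ, x.coeff n =
      phiCoeff p a n * (vev Φ (alpha b n Φ)).coeff (-1) := by
    intro n
    rw [hx, HahnSeries.coeff_single_mul, coeff_disk, one_mul]
    simp
  have h := coeff_pow_eq_finsum x s N
  simp only [hxc] at h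
  rw [← h, hx, mul_pow, HahnSeries.single_pow, HahnSeries.coeff_single_mul, one_pow, one_mul]
  congr 1
  simp
  ring

/-- The weak coupling limit of the currents. -/
lemma vev_currentMode {p : ℕ} (hp : 0 < p) (b : ℕ+ →₀ ℂ) {Φ : FockState}
    (hΦ : MvPowerSeries.constantCoeff Φ ≠ 0) (hgenus : HasGenusExpansion Φ)
    (a s : ℕ) (N : ℤ) :
    VanishesBelow (vev Φ (currentMode p b a s N Φ)) (-s) ∧
      (vev Φ (currentMode p b a s N Φ)).coeff (-s) =
        (disk p b Φ a ^ s).coeff (N + p * s) := by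
  have hz : ∀ (r : ℕ) (k : ℤ), k < -r → ∑ᶠ m ∈ {m : Fin r → ℤ | ∑ i, m i = N},
        ((s.factorial : ℂ) / (r.factorial : ℂ) *
          PowerSeries.coeff s (orderingFactor p * ∏ i, phiIncrement p a (m i))) *
            (vev Φ (normalProd b m Φ)).coeff k = 0 := by
    intro r k hk
    refine finsum_mem_eq_zero_of_forall_eq_zero fun m _ => ?_
    rw [(vev_normalProd b hΦ hgenus m).1 k hk, mul_zero]
  constructor
  · intro k hk
    rw [coeff_vev_currentMode]
    refine Finset.sum_eq_zero fun r hr => hz r k ?_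
    have := Finset.mem_range.1 hr
    omega
  · rw [coeff_vev_currentMode, Finset.sum_range_succ, Finset.sum_eq_zero, zero_add,
      coeff_disk_pow]
    · refine finsum_mem_congr rfl fun m _ => ?_
      rw [coeff_orderingFactor_mul_prod hp, (vev_normalProd b hΦ hgenus m).2,
        div_self (by exact_mod_cast s.factorial_ne_zero), one_mul, Finset.prod_mul_distrib]
    · intro r hr
      refine hz r _ ?_
      have := Finset.mem_range.1 hr
      omega

end Currents

/-! ### The branches of the disk amplitude and the master equations -/

section Disk

lemma omega_isPrimitiveRoot {p : ℕ} (hp : 0 < p) : IsPrimitiveRoot (omega p) p :=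
  Complex.isPrimitiveRoot_exp p hp.ne'

lemma omega_ne_zero (p : ℕ) : omega p ≠ 0 := Complex.exp_ne_zero _

lemma coeff_disk_eq {p : ℕ} (hp : 0 < p) (b : ℕ+ →₀ ℂ) (Φ : FockState) (a : ℕ) (k : ℤ) :
    (disk p b Φ a).coeff k = omega p ^ (-(k * a)) * (disk p b Φ 0).coeff k := by
  have h1 : omega p ^ (-((k - p) * a)) = omega p ^ (-(k * a)) := by
    have h2 : -((k - p) * a) = -(k * a) + (p : ℤ) * a := by ring
    rw [h2, zpow_add₀ (omega_ne_zero p), zpow_mul, zpow_natCast (omega p) p,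
      (omega_isPrimitiveRoot hp).pow_eq_one, one_zpow, mul_one]
  rw [coeff_disk, coeff_disk, phiCoeff, phiCoeff, h1]
  simp
  ring

/-- The substitution `z ↦ ω ^ (-a) z` taking `Q_0` to `Q_a` is multiplicative: a tuple of exponents
with sum `k` always collects the factor `ω ^ (-k a)`. -/
lemma coeff_disk_pow_eq {p : ℕ} (hp : 0 < p) (b : ℕ+ →₀ ℂ) (Φ : FockState) (a s : ℕ) (k : ℤ) :
    (disk p b Φ a ^ s).coeff k = omega p ^ (-(k * a)) * (disk p b Φ 0 ^ s).coeff k := by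
  have hfin : ∀ c : ℂ, ∀ f : (Fin s → ℤ) → ℂ, ∀ t : Set (Fin s → ℤ), c ≠ 0 →
      ∑ᶠ m ∈ t, c * f m = c * ∑ᶠ m ∈ t, f m := by
    intro c f t hc
    simp only [← smul_eq_mul, ← smul_finsum]
  rw [coeff_pow_eq_finsum, coeff_pow_eq_finsum,
    ← hfin _ _ _ (zpow_ne_zero _ (omega_ne_zero p))]
  refine finsum_mem_congr rfl fun m hm => ?_
  have hm' : ∑ i, m i = k := hm
  have hprod : ∀ t : Finset (Fin s),
      ∏ i ∈ t, omega p ^ (-(m i * a)) = omega p ^ (-((∑ i ∈ t, m i) * (a : ℤ))) := by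
    classical
    intro t
    induction t using Finset.induction_on with
    | empty => simp
    | insert i t hi ih =>
      rw [Finset.prod_insert hi, ih, Finset.sum_insert hi, ← zpow_add₀ (omega_ne_zero p)]
      congr 1
      ring
  simp only [coeff_disk_eq hp b Φ a]
  rw [Finset.prod_mul_distrib, hprod, hm']

lemma sum_omega_zpow {p : ℕ} (hp : 0 < p) (k : ℤ) :
    ∑ a ∈ Finset.range p, omega p ^ (-(k * a)) = if (p : ℤ) ∣ k then (p : ℂ) else 0 := by
  have hω := omega_isPrimitiveRoot hp
  have h1 : ∀ a : ℕ, omega p ^ (-(k * a)) = (omega p ^ (-k)) ^ a := by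
    intro a
    rw [← zpow_natCast, ← zpow_mul, neg_mul]
  simp only [h1]
  split_ifs with h
  · rw [(hω.zpow_eq_one_iff_dvd (-k)).2 (by simpa using h)]
    simp
  · have hne : omega p ^ (-k) ≠ 1 := fun h2 =>
      h (by simpa using (hω.zpow_eq_one_iff_dvd (-k)).1 h2)
    have h3 := mul_geom_sum (omega p ^ (-k)) p
    have h4 : (omega p ^ (-k)) ^ p = 1 := by
      rw [← zpow_natCast, zpow_comm, zpow_natCast, hω.pow_eq_one, one_zpow]
    rw [h4, sub_self] at h3
    exact (mul_eq_zero.1 h3).resolve_left (sub_ne_zero.2 hne)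

lemma coeff_zetaHom {p : ℕ} (hp : 0 < p) (f : Polynomial ℂ) (k : ℤ) :
    (zetaHom p f).coeff k = if (p : ℤ) ∣ k ∧ k ≤ 0 then f.coeff (-k / p).toNat else 0 := by
  have hp' : (p : ℤ) ≠ 0 := by exact_mod_cast hp.ne'
  have h1 : zetaHom p f = f.sum fun l c => HahnSeries.single (-((l : ℤ) * p)) c := by
    rw [zetaHom]
    change Polynomial.aeval _ f = _
    rw [Polynomial.aeval_eq_sum_range, Polynomial.sum_over_range _ (by simp)]
    refine Finset.sum_congr rfl fun l _ => ?_
    rw [HahnSeries.single_pow, one_pow, Algebra.smul_def, LaurentSeries.algebraMap_apply,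
      HahnSeries.C_apply, HahnSeries.single_mul_single]
    simp
  rw [h1, Polynomial.sum, HahnSeries.coeff_sum]
  split_ifs with h
  · obtain ⟨⟨j, rfl⟩, hj⟩ := h
    have hj' : j ≤ 0 := by
      by_contra hlt
      have : 0 < (p : ℤ) * j := mul_pos (by exact_mod_cast hp) (by omega)
      omega
    obtain ⟨l, rfl⟩ : ∃ l : ℕ, j = -(l : ℤ) := ⟨(-j).toNat, by omega⟩
    have h2 : (-((p : ℤ) * -(l : ℤ)) / p).toNat = l := by
      rw [mul_neg, neg_neg, Int.mul_ediv_cancel_left _ hp', Int.toNat_natCast]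
    rw [h2, Finset.sum_eq_single l]
    · rw [mul_neg, mul_comm, HahnSeries.coeff_single_same]
    · intro i _ hi
      refine HahnSeries.coeff_single_of_ne fun h3 => hi ?_
      have h4 : (p : ℤ) * i = p * l := by linarith
      exact_mod_cast mul_left_cancel₀ hp' h4
    · intro hl
      rw [Polynomial.notMem_support_iff.1 hl, map_zero, HahnSeries.coeff_zero]
  · refine Finset.sum_eq_zero fun l _ => HahnSeries.coeff_single_of_ne fun h2 => h ?_
    subst h2
    refine ⟨⟨-l, by ring⟩, ?_⟩
    have : (0 : ℤ) ≤ l * p := by positivity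
    omega

/-- The exponent `l * p` of `z` is `ζ ^ (-l)`, to which the mode `n = l - s` contributes. The range
`n ≥ -s + 1` of the constraints is exactly `l ≥ 1`. -/
lemma coeff_sum_disk_pow_eq_zero {p : ℕ} (hp : 0 < p) (b : ℕ+ →₀ ℂ) {Φ : FockState}
    (hΦ : MvPowerSeries.constantCoeff Φ ≠ 0) (hgenus : HasGenusExpansion Φ)
    (hW : WConstraints p b Φ) {s : ℕ} (hs : 1 ≤ s) {l : ℤ} (hl : 1 ≤ l) :
    (∑ a ∈ Finset.range p, disk p b Φ a ^ s).coeff (l * p) = 0 := by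
  have h := congrArg (fun Ψ => (vev Φ Ψ).coeff (-(s : ℤ))) (hW s hs (l - s) (by omega))
  simp only [coeff_vev, wMode, map_sum, map_zero] at h
  rw [HahnSeries.coeff_sum, ← h]
  refine Finset.sum_congr rfl fun a _ => ?_
  rw [← coeff_vev, (vev_currentMode hp b hΦ hgenus a s _).2]
  congr 1
  ring

lemma sum_disk_pow {p : ℕ} (hp : 0 < p) (b : ℕ+ →₀ ℂ) {Φ : FockState}
    (hΦ : MvPowerSeries.constantCoeff Φ ≠ 0) (hgenus : HasGenusExpansion Φ)
    (hW : WConstraints p b Φ) {s : ℕ} (hs : 1 ≤ s) :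
    ∑ a ∈ Finset.range p, disk p b Φ a ^ s
      = zetaHom p ((p : ℂ) • polPart p (disk p b Φ 0 ^ s)) := by
  have hp' : (p : ℤ) ≠ 0 := by exact_mod_cast hp.ne'
  ext k
  have hsum : (∑ a ∈ Finset.range p, disk p b Φ a ^ s).coeff k =
      (if (p : ℤ) ∣ k then (p : ℂ) else 0) * (disk p b Φ 0 ^ s).coeff k := by
    rw [HahnSeries.coeff_sum, ← sum_omega_zpow hp, Finset.sum_mul]
    exact Finset.sum_congr rfl fun a _ => coeff_disk_pow_eq hp b Φ a s k
  rw [coeff_zetaHom hp]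
  split_ifs with h
  · obtain ⟨⟨j, rfl⟩, hj⟩ := h
    have hdiv : -((p : ℤ) * j) / p = -j := by
      rw [← mul_neg, Int.mul_ediv_cancel_left _ hp']
    have hj' : 0 ≤ -j := by
      by_contra hlt
      have : 0 < (p : ℤ) * j := mul_pos (by exact_mod_cast hp) (by omega)
      omega
    rw [hsum, if_pos (dvd_mul_right _ _), hdiv, Polynomial.coeff_smul, coeff_polPart hp,
      Int.toNat_of_nonneg hj', smul_eq_mul]
    congr 2
    ring
  -- Outside the polynomial part, negative integer powers of `ζ` vanish by the constraints, and
  -- fractional powers by the sum over roots of unity.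
  · by_cases hdvd : (p : ℤ) ∣ k
    · obtain ⟨j, rfl⟩ := hdvd
      have hj : 1 ≤ j := by
        by_contra hlt
        exact h ⟨dvd_mul_right _ _, mul_nonpos_of_nonneg_of_nonpos (by positivity) (by omega)⟩
      rw [mul_comm]
      exact coeff_sum_disk_pow_eq_zero hp b hΦ hgenus hW hs hj
    · rw [hsum, if_neg hdvd, zero_mul]

lemma natCast_smul_aPoly (p : ℕ) (b : ℕ+ →₀ ℂ) (Φ : FockState) {s : ℕ} (hs : 1 ≤ s) :
    (s : ℂ) • aPoly p b Φ s = (p : ℂ) • polPart p (disk p b Φ 0 ^ s) := by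
  have : (s : ℂ) ≠ 0 := by
    have : s ≠ 0 := by omega
    exact_mod_cast this
  rw [aPoly, smul_smul, mul_div_cancel₀ _ this]

/-- The algebraic curve in factorized form. -/
lemma prod_X_sub_disk {p : ℕ} (hp : 0 < p) (b : ℕ+ →₀ ℂ) {Φ : FockState}
    (hΦ : MvPowerSeries.constantCoeff Φ ≠ 0) (hgenus : HasGenusExpansion Φ)
    (hW : WConstraints p b Φ) :
    ∏ a ∈ Finset.range p, (Polynomial.X - Polynomial.C (disk p b Φ a))
      = (curve p b Φ).map (zetaHom p) := by
  have : CharZero ZSeries :=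
    charZero_of_injective_ringHom (f := (HahnSeries.C : ℂ →+* ZSeries)) HahnSeries.C_injective
  have hnewton := map_schur_eq_esymm (zetaHom p) (fun i : Fin p => disk p b Φ i)
    (aPoly p b Φ) (by
      intro s hs
      rw [Fin.sum_univ_eq_sum_range (fun a => disk p b Φ a ^ s),
        sum_disk_pow hp b hΦ hgenus hW hs, ← natCast_smul_aPoly p b Φ hs,
        Nat.cast_smul_eq_nsmul, map_nsmul, nsmul_eq_mul])
  have hvieta := Multiset.prod_X_sub_X_eq_sum_esymm
    (Finset.univ.val.map fun i : Fin p => disk p b Φ i)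
  rw [Multiset.map_map, Multiset.card_map, Finset.card_val, Finset.card_univ,
    Fintype.card_fin] at hvieta
  rw [← Fin.prod_univ_eq_prod_range (fun a => Polynomial.X - Polynomial.C (disk p b Φ a))]
  refine hvieta.trans ?_
  rw [curve, Polynomial.map_sum]
  refine Finset.sum_congr rfl fun k _ => ?_
  rw [Polynomial.map_mul, Polynomial.map_C, Polynomial.map_pow, Polynomial.map_X, hnewton k,
    map_mul, map_pow, map_neg, map_one]
  ring

end Disk

end MinimalString

theorem theorem5 (p : ℕ) (hp : 0 < p) (b : ℕ+ →₀ ℂ) (Φ : FockState)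
    (hΦ : MvPowerSeries.constantCoeff Φ ≠ 0)
    (hgenus : HasGenusExpansion Φ)
    (hW : WConstraints p b Φ) :
    -- the disk amplitudes `Q_a(ζ) = Q_0(exp (2 π i a) ζ)` are the branches of `Q_0`
    (∀ a < p, ∀ k : ℤ,
      (disk p b Φ a).coeff k = omega p ^ (-(k * a)) * (disk p b Φ 0).coeff k) ∧
    -- weak coupling limit: `⟨𝓦_a^s(ζ)⟩ = g ^ (-s) * Q_a(ζ) ^ s + O(g ^ (-s + 1))`
    (∀ s : ℕ, 1 ≤ s → ∀ a < p, ∀ N : ℤ,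
      (∀ k : ℤ, k < -(s : ℤ) → (vev Φ (currentMode p b a s N Φ)).coeff k = 0) ∧
      (vev Φ (currentMode p b a s N Φ)).coeff (-(s : ℤ)) =
        (disk p b Φ a ^ s).coeff (N + p * s)) ∧
    -- master equations: `∑_a Q_a ^ s = p [Q_0 ^ s]_pol = s a_s(ζ)`
    (∀ s : ℕ, 1 ≤ s →
      ∑ a ∈ Finset.range p, disk p b Φ a ^ s
        = zetaHom p ((p : ℂ) • polPart p (disk p b Φ 0 ^ s)) ∧
      ∑ a ∈ Finset.range p, disk p b Φ a ^ s = zetaHom p ((s : ℂ) • aPoly p b Φ s)) ∧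
    -- `∏_a (Q - Q_a) = F(ζ, Q) = ∑_k Q ^ (p - k) 𝓢_k(-a(ζ))`, polynomial in `ζ` and `Q`
    (∏ a ∈ Finset.range p, (Polynomial.X - Polynomial.C (disk p b Φ a))
      = (curve p b Φ).map (zetaHom p)) ∧
    -- the disk amplitude lies on the algebraic curve: `F(ζ, Q_0(ζ)) = 0`
    (curve p b Φ).eval₂ (zetaHom p) (disk p b Φ 0) = 0 := by
  refine ⟨fun a _ k => coeff_disk_eq hp b Φ a k,
    fun s _ a _ N => vev_currentMode hp b hΦ hgenus a s N,
    fun s hs => ⟨sum_disk_pow hp b hΦ hgenus hW hs, ?_⟩,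
    prod_X_sub_disk hp b hΦ hgenus hW, ?_⟩
  · rw [natCast_smul_aPoly p b Φ hs]
    exact sum_disk_pow hp b hΦ hgenus hW hs
  -- The factor `a = 0` of the product vanishes at `Q = Q_0`.
  · rw [← Polynomial.eval_map, ← prod_X_sub_disk hp b hΦ hgenus hW, Polynomial.eval_prod]
    exact Finset.prod_eq_zero (Finset.mem_range.2 hp) (by simp)
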